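/- All groups are abelian, and all topological groups are Hausdorff. A group topology on an abelian group $G$ is called precompact if it is (Hausdorff and) totally bounded, i.e. for every neighbourhood $U$ of $0$ there is a finite $F\subseteq G$ with $F+U=G$. A precompact group topology $\tau$ on $G$ is called ss-characterized (single sequence characterized) if there is a sequence $(u_n)_{n\in\mathbb{N}}$ in $G$ such that $\tau$ is the finest precompact group topology on $G$ in which $u_n\to 0$ (so in particular $u_n \to 0$ in $\tau$). A topological group $G$ is called an Arhangel'skiĭ group if its weight $w(G)$ (the least cardinality of a base of its topology) satisfies $w(G)\le |G|$. **Corollary C3.** Let $(G,\tau)$ be a precompact abelian group that is an Arhangel'skiĭ group. Then $(G,\tau)$ is ss-characterized if and only if it is both metrizable and countable. -/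

import Mathlib

open Filter Topology

/-- A precompact group topology on an abelian group: a Hausdorff group topology that is totally
bounded with respect to its canonical uniformity. -/
structure IsPrecompactGroupTopology {G : Type*} [AddCommGroup G] (τ : TopologicalSpace G) :
    Prop where
  isTopologicalAddGroup : IsTopologicalAddGroup G
  t2Space : T2Space G
  totallyBounded :
    @TotallyBounded G (IsTopologicalAddGroup.rightUniformSpace G) Set.univ

/-- Precompactness in terms of translates: finitely many translates of each neighbourhood of zero
cover the group. -/
theorem isPrecompactGroupTopology_iff {G : Type*} [AddCommGroup G] (τ : TopologicalSpace G) :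
    IsPrecompactGroupTopology τ ↔ IsTopologicalAddGroup G ∧ T2Space G ∧
      ∀ U ∈ 𝓝 (0 : G), ∃ F : Set G, F.Finite ∧ Set.univ ⊆ ⋃ x ∈ F, (fun y => x + y) '' U := by
  constructor
  · rintro ⟨h1, h2, h3⟩
    let _ := IsTopologicalAddGroup.rightUniformSpace G
    have : IsUniformAddGroup G := isUniformAddGroup_of_addCommGroup
    exact ⟨h1, h2, totallyBounded_iff_subset_finite_iUnion_nhds_zero.1 h3⟩
  · rintro ⟨h1, h2, h3⟩
    let _ := IsTopologicalAddGroup.rightUniformSpace G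
    have : IsUniformAddGroup G := isUniformAddGroup_of_addCommGroup
    exact ⟨h1, h2, totallyBounded_iff_subset_finite_iUnion_nhds_zero.2 h3⟩

/-- The precompact group topologies on `G` in which the sequence `u` converges to zero. -/
def precompactTopologiesConverging {G : Type*} [AddCommGroup G] (u : ℕ → G) :
    Set (TopologicalSpace G) :=
  {σ | IsPrecompactGroupTopology σ ∧ Tendsto u atTop (@nhds G σ 0)}

/-- `u` is a TB-sequence: it converges to zero in some precompact group topology. -/
def IsTBSequence {G : Type*} [AddCommGroup G] (u : ℕ → G) : Prop :=
  (precompactTopologiesConverging u).Nonempty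

/-- The sequence `u` characterizes `τ`: it is a TB-sequence and `τ` is the finest precompact group
topology in which `u` converges to zero. In Mathlib's order on topologies `τ ≤ σ` means that `τ`
is finer than `σ`, so that finest means least. -/
def Characterizes {G : Type*} [AddCommGroup G] (u : ℕ → G) (τ : TopologicalSpace G) : Prop :=
  IsTBSequence u ∧ IsLeast (precompactTopologiesConverging u) τ

/-- `τ` is single sequence characterized. -/
def IsSSCharacterized {G : Type*} [AddCommGroup G] (τ : TopologicalSpace G) : Prop :=
  ∃ u : ℕ → G, Characterizes u τ

/-- The weight of a topological space: the least cardinality of a base. -/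
noncomputable def topWeight (X : Type*) [TopologicalSpace X] : Cardinal :=
  sInf {κ : Cardinal | ∃ B : Set (Set X), TopologicalSpace.IsTopologicalBasis B ∧
    Cardinal.mk B = κ}

/-- The Arhangel'skii property: the weight does not exceed the cardinality. -/
def IsArhangelskii (X : Type*) [TopologicalSpace X] : Prop :=
  topWeight X ≤ Cardinal.mk X

/-! Everything passes through characters: the topology of a precompact group is induced by its
continuous characters (complete, then separate points of a compact group). Necessity: if `u`
characterizes `τ`, any `χ` with `χ (u n) → 0` is continuous, since adjoining `χ` to `τ` keeps it
precompact. So every character of `G ⧸ N`, with `N` the countable subgroup generated by `u`, yields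
a continuous character of `G`. There are at most weight times `ℵ₀` of these, whereas an uncountable
group has more characters than elements (`mk_lt_mk_characters`); hence `G` is countable, and its
weight too. Sufficiency: only finitely many characters are small on a given neighbourhood of zero.
Compactness of the space of all characters selects finite sets inside shrinking neighbourhoods, such
that a character eventually small on them agrees with one small on a neighbourhood. Enumerating
these sets gives `u`. -/

/-! ### Absence of small subgroups in the circle. -/

namespace UnitAddCircle

theorem norm_two_nsmul {x : UnitAddCircle} (hx : ‖x‖ ≤ 1 / 4) : ‖2 • x‖ = 2 * ‖x‖ := by
  obtain ⟨y, rfl⟩ := QuotientAddGroup.mk_surjective x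
  change ‖(y : UnitAddCircle)‖ ≤ 1 / 4 at hx
  change ‖2 • (y : UnitAddCircle)‖ = 2 * ‖(y : UnitAddCircle)‖
  rw [UnitAddCircle.norm_eq] at hx ⊢
  have h1 : (y : UnitAddCircle) = ((y - round y : ℝ) : UnitAddCircle) := by
    rw [AddCircle.coe_sub, eq_comm, sub_eq_self, AddCircle.coe_eq_zero_iff]
    exact ⟨round y, by simp⟩
  rw [h1, ← AddCircle.coe_nsmul,
    (AddCircle.norm_coe_eq_abs_iff (1 : ℝ) one_ne_zero).2, nsmul_eq_mul, abs_mul]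
  · simp
  · rw [nsmul_eq_mul, abs_mul]
    norm_num
    linarith

theorem norm_two_pow_nsmul {x : UnitAddCircle} {n : ℕ}
    (hx : ∀ k < n, ‖2 ^ k • x‖ ≤ 1 / 4) : ‖2 ^ n • x‖ = 2 ^ n * ‖x‖ := by
  induction n with
  | zero => simp
  | succ n ih =>
    rw [pow_succ', mul_nsmul', norm_two_nsmul (hx n n.lt_succ_self),
      ih fun k hk => hx k (hk.trans n.lt_succ_self), pow_succ', mul_assoc]

/-- Doubling exactly doubles the norm while it stays within 1/4. The finite form gives continuity of
characters; letting `n` grow excludes small subgroups. -/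
theorem norm_le_of_two_pow_nsmul {x : UnitAddCircle} {n : ℕ}
    (hx : ∀ k ≤ n, ‖2 ^ k • x‖ ≤ 1 / 4) : ‖x‖ ≤ (1 / 2) ^ n := by
  have h1 := norm_two_pow_nsmul fun k (hk : k < n) => hx k hk.le
  have h2 := hx n le_rfl
  rw [h1] at h2
  rw [one_div, inv_pow, ← one_div, le_div_iff₀ (by positivity)]
  linarith

theorem eq_zero_of_two_pow_nsmul {x : UnitAddCircle} (hx : ∀ k : ℕ, ‖2 ^ k • x‖ ≤ 1 / 4) :
    x = 0 := by
  have h : ‖x‖ ≤ 0 :=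
    ge_of_tendsto' (tendsto_pow_atTop_nhds_zero_of_lt_one (by norm_num) (by norm_num))
      fun n => norm_le_of_two_pow_nsmul fun k (_ : k ≤ n) => hx k
  exact norm_le_zero_iff.1 h

end UnitAddCircle

/-- The circle has no small subgroups: homomorphisms that are uniformly close are equal. -/
theorem AddMonoidHom.eq_of_norm_sub_le {G : Type*} [AddCommGroup G] {χ ψ : G →+ UnitAddCircle}
    (h : ∀ x, ‖χ x - ψ x‖ ≤ 1 / 4) : χ = ψ := by
  refine AddMonoidHom.ext fun x => sub_eq_zero.1 ?_
  refine UnitAddCircle.eq_zero_of_two_pow_nsmul fun k => ?_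
  rw [nsmul_sub, ← map_nsmul, ← map_nsmul]
  exact h (2 ^ k • x)

/-! ### Characters small on a neighbourhood of zero. -/

/-- The characters of `G` that are small on `U`. -/
def smallCharacters {G : Type*} [AddCommGroup G] (U : Set G) : Set (G →+ UnitAddCircle) :=
  {χ | ∀ x ∈ U, ‖χ x‖ ≤ 1 / 16}

theorem smallCharacters_anti {G : Type*} [AddCommGroup G] {U V : Set G} (h : U ⊆ V) :
    smallCharacters V ⊆ smallCharacters U := fun _ hχ x hx => hχ x (h hx)

theorem continuous_of_mem_smallCharacters {G : Type*} [AddCommGroup G] [TopologicalSpace G]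
    [IsTopologicalAddGroup G] {U : Set G} (hU : U ∈ 𝓝 0) {χ : G →+ UnitAddCircle}
    (hχ : χ ∈ smallCharacters U) : Continuous χ := by
  refine continuous_of_continuousAt_zero χ ?_
  rw [ContinuousAt, map_zero, tendsto_zero_iff_norm_tendsto_zero, Metric.tendsto_nhds]
  intro ε hε
  obtain ⟨n, hn⟩ := exists_pow_lt_of_lt_one hε (show (1 / 2 : ℝ) < 1 by norm_num)
  have h : ∀ᶠ x in 𝓝 (0 : G), ∀ k ∈ Set.Iic n, 2 ^ k • x ∈ U := by
    refine (eventually_all_finite (Set.finite_Iic n)).2 fun k _ => ?_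
    have : Tendsto (fun x : G => 2 ^ k • x) (𝓝 0) (𝓝 0) := by
      simpa using (continuous_nsmul (M := G) (2 ^ k)).tendsto 0
    exact this hU
  filter_upwards [h] with x hx
  rw [dist_zero_right, norm_norm]
  refine (UnitAddCircle.norm_le_of_two_pow_nsmul fun k hk => ?_).trans_lt hn
  rw [← map_nsmul]
  exact (hχ _ (hx k hk)).trans (by norm_num)

/-- The torus indexed by `F` has a finite 1/32-net. Two such characters near the same net point
differ everywhere by at most 1/32 + 1/32 + 1/16 + 1/16 < 1/4, hence coincide. -/
theorem finite_smallCharacters {G : Type*} [AddCommGroup G] {U F : Set G} (hF : F.Finite)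
    (hU : Set.univ ⊆ ⋃ x ∈ F, (fun y => x + y) '' U) : (smallCharacters U).Finite := by
  have : Fintype F := hF.fintype
  obtain ⟨t, -, ht, hcov⟩ := (isCompact_univ (X := F → UnitAddCircle)).finite_cover_balls
    (show (0 : ℝ) < 1 / 32 by norm_num)
  have hex : ∀ χ : G →+ UnitAddCircle, ∃ p ∈ t, ∀ x : F, dist (χ x) (p x) < 1 / 32 := by
    intro χ
    obtain ⟨p, hp, h⟩ := Set.mem_iUnion₂.1 (hcov (Set.mem_univ fun x : F => χ x))
    exact ⟨p, hp, fun x => (dist_le_pi_dist _ _ x).trans_lt h⟩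
  choose p hp hpd using hex
  refine Set.Finite.of_finite_image (f := p) (ht.subset ?_) fun χ hχ ψ hψ heq => ?_
  · rintro _ ⟨χ, -, rfl⟩
    exact hp χ
  · refine AddMonoidHom.eq_of_norm_sub_le fun g => ?_
    obtain ⟨f, hf, u, hu, rfl⟩ := Set.mem_iUnion₂.1 (hU (Set.mem_univ g))
    have h1 := hpd χ ⟨f, hf⟩
    have h2 := hpd ψ ⟨f, hf⟩
    rw [← heq] at h2
    have h3 := dist_triangle_right (χ f) (ψ f) (p χ ⟨f, hf⟩)
    rw [dist_eq_norm] at h3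
    have h4 := norm_add_le (χ f - ψ f) (χ u - ψ u)
    have h5 := norm_sub_le (χ u) (ψ u)
    have h6 := hχ u hu
    have h7 := hψ u hu
    simp only [map_add, add_sub_add_comm]
    linarith

theorem IsPrecompactGroupTopology.finite_smallCharacters {G : Type*} [AddCommGroup G]
    [τ : TopologicalSpace G] (h : IsPrecompactGroupTopology τ) {U : Set G} (hU : U ∈ 𝓝 0) :
    (smallCharacters U).Finite := by
  obtain ⟨F, hF, hFU⟩ := ((isPrecompactGroupTopology_iff τ).1 h).2.2 U hU
  exact _root_.finite_smallCharacters hF hFU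

/-! ### Characters from a unitary representation of a compact abelian group. -/

section Representation

open MeasureTheory ContinuousLinearMap

theorem Continuous.integrable_of_compactSpace {X E : Type*} [TopologicalSpace X] [CompactSpace X]
    [MeasurableSpace X] [BorelSpace X] {μ : Measure X} [IsFiniteMeasure μ] [NormedAddCommGroup E]
    {f : X → E} (hf : Continuous f) : Integrable f μ :=
  hf.integrable_of_hasCompactSupport (.of_compactSpace _)

variable {K H : Type*} [TopologicalSpace K] [CompactSpace K] [MeasurableSpace K] [BorelSpace K]
  (μ : Measure K) [IsFiniteMeasure μ] [NormedAddCommGroup H] [InnerProductSpace ℂ H]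

theorem integrable_smul_orbit {L : K → H →L[ℂ] H} (hL : ∀ g, Continuous fun x => L x g)
    (f : C(K, ℂ)) (g : H) : Integrable (fun y => f y • L y g) μ :=
  (f.continuous.smul (hL g)).integrable_of_compactSpace

/-- The operators `g ↦ ∫ f y • L y g` attached to a strongly continuous isometric
representation `L`, as a function of `f`. -/
noncomputable def smearing (L : K → H →L[ℂ] H) (hL : ∀ g, Continuous fun x => L x g)
    (hn : ∀ x g, ‖L x g‖ = ‖g‖) : C(K, ℂ) →L[ℂ] H →L[ℂ] H :=
  LinearMap.mkContinuous₂
    (LinearMap.mk₂ ℂ (fun (f : C(K, ℂ)) (g : H) => ∫ y, f y • L y g ∂μ)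
      (fun f f' g => by
        simp only [ContinuousMap.add_apply, add_smul]
        exact integral_add (integrable_smul_orbit μ hL f g) (integrable_smul_orbit μ hL f' g))
      (fun c f g => by
        simp only [ContinuousMap.smul_apply, smul_assoc]
        exact integral_smul c _)
      (fun f g g' => by
        simp only [map_add, smul_add]
        exact integral_add (integrable_smul_orbit μ hL f g) (integrable_smul_orbit μ hL f g'))
      (fun c f g => by
        simp only [map_smul]
        rw [← integral_smul]
        simp only [smul_comm c]))
    (μ.real Set.univ) (fun f g => by
      refine (norm_integral_le_of_norm_le_const (C := ‖f‖ * ‖g‖)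
        (ae_of_all _ fun y => ?_)).trans_eq (by ring)
      rw [norm_smul, hn]
      gcongr
      exact f.norm_coe_le_norm y)

variable {μ} {L : K → H →L[ℂ] H} {hL : ∀ g, Continuous fun x => L x g}
  {hn : ∀ x g, ‖L x g‖ = ‖g‖}

theorem smearing_apply (f : C(K, ℂ)) (g : H) :
    smearing μ L hL hn f g = ∫ y, f y • L y g ∂μ := rfl

theorem smearing_commute [CompleteSpace H] {B : H →L[ℂ] H} (hB : ∀ x, B * L x = L x * B) (f : C(K, ℂ)) :
    B * smearing μ L hL hn f = smearing μ L hL hn f * B := by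
  ext g
  simp only [mul_apply_eq_comp, smearing_apply]
  rw [← B.integral_comp_comm (integrable_smul_orbit μ hL f g)]
  refine integral_congr_ae (ae_of_all _ fun y => ?_)
  have := congrArg (fun A : H →L[ℂ] H => A g) (hB y)
  simp only [mul_apply_eq_comp] at this
  simp only [map_smul, this]

variable [AddCommGroup K] [IsTopologicalAddGroup K] [CompleteSpace H]

/-- The translates of a continuous function depend continuously on the translation. -/
noncomputable def translates {K : Type*} [TopologicalSpace K] [AddCommGroup K]
    [IsTopologicalAddGroup K] (f : C(K, ℂ)) : C(K, C(K, ℂ)) :=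
  (ContinuousMap.mk (fun p : K × K => f (p.2 - p.1))
    (f.continuous.comp (continuous_snd.sub continuous_fst))).curry

/-- Invariance of `μ` moves `L x` onto `f`. Since translation is continuous in the sup norm, strong
continuity of `L` becomes norm continuity after smearing. -/
theorem mul_smearing [μ.IsAddLeftInvariant] (hadd : ∀ x y, L (x + y) = L x * L y)
    (f : C(K, ℂ)) (x : K) :
    L x * smearing μ L hL hn f = smearing μ L hL hn (translates f x) := by
  ext g
  simp only [mul_apply_eq_comp, smearing_apply]
  rw [← (L x).integral_comp_comm (integrable_smul_orbit μ hL f g),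
    ← integral_add_left_eq_self (μ := μ) (fun y => translates f x y • L y g) x]
  refine integral_congr_ae (ae_of_all _ fun y => ?_)
  simp [translates, hadd]

/-- For a bump `f` of mass `c` concentrated near zero, the smeared vector is within `c * ε / 3` of
`c • g`. If `L x` fixed it, the displacement `c * ε` of `c • g` would be at most two thirds of
itself. -/
theorem exists_mul_smearing_ne [T2Space K] [μ.IsOpenPosMeasure] (h0 : L 0 = 1)
    {x : K} (hx : L x ≠ 1) :
    ∃ f : C(K, ℂ), L x * smearing μ L hL hn f ≠ smearing μ L hL hn f := by
  obtain ⟨g, hg⟩ : ∃ g, L x g ≠ g := by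
    by_contra! h
    exact hx (ContinuousLinearMap.ext h)
  set ε := ‖L x g - g‖ with hε
  have hε0 : 0 < ε := norm_pos_iff.2 (sub_ne_zero.2 hg)
  have hN : IsOpen {y | ‖L y g - g‖ < ε / 3} :=
    isOpen_lt ((hL g).sub continuous_const).norm continuous_const
  obtain ⟨f, hf1, hf0, hf⟩ := exists_continuous_zero_one_of_isClosed hN.isClosed_compl
    (isClosed_singleton (x := (0 : K))) (by
      rw [Set.disjoint_singleton_right]
      simpa [h0] using hε0)
  have hc : 0 < ∫ y, f y ∂μ :=
    f.continuous.integral_pos_of_hasCompactSupport_nonneg_nonzero (.of_compactSpace _)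
      (fun y => (hf y).1) (x := 0) (by simp [hf0 (Set.mem_singleton _)])
  set c := ∫ y, f y ∂μ
  let f' : C(K, ℂ) := ⟨fun y => (f y : ℂ), Complex.continuous_ofReal.comp f.continuous⟩
  refine ⟨f', fun heq => ?_⟩
  have heq' : L x (smearing μ L hL hn f' g) = smearing μ L hL hn f' g :=
    congrArg (fun A : H →L[ℂ] H => A g) heq
  have happ : smearing μ L hL hn f' g - c • g = ∫ y, f y • (L y g - g) ∂μ := by
    rw [smearing_apply, ← integral_smul_const]
    rw [← integral_sub (integrable_smul_orbit μ hL f' g)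
      (show Integrable (fun y => f y • g) μ from
        (f.continuous.smul continuous_const).integrable_of_compactSpace)]
    refine integral_congr_ae (ae_of_all _ fun y => ?_)
    simp only [smul_sub]
    rfl
  have hbd : ‖smearing μ L hL hn f' g - c • g‖ ≤ c * (ε / 3) := by
    rw [happ, ← integral_mul_const]
    refine norm_integral_le_of_norm_le (f.continuous.mul continuous_const).integrable_of_compactSpace
      (ae_of_all _ fun y => ?_)
    rw [norm_smul, Real.norm_of_nonneg (hf y).1]
    by_cases hy : ‖L y g - g‖ < ε / 3
    · exact mul_le_mul_of_nonneg_left hy.le (hf y).1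
    · rw [hf1 (by simpa using hy)]
      simp
  have h1 : c • (L x g - g) = (smearing μ L hL hn f' g - c • g) -
      L x (smearing μ L hL hn f' g - c • g) := by
    rw [map_sub, heq', ContinuousLinearMap.map_smul_of_tower, smul_sub]
    abel
  have h2 : c * ε ≤ c * (ε / 3) + c * (ε / 3) := by
    have := norm_sub_le (smearing μ L hL hn f' g - c • g)
      (L x (smearing μ L hL hn f' g - c • g))
    rw [← h1, hn, norm_smul, Real.norm_of_nonneg hc.le, ← hε] at this
    linarith
  nlinarith [mul_pos hc hε0]

/-- A compact abelian group with a strongly continuous unitary representation that moves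
under `x` has a continuous character that is nontrivial at `x`. -/
theorem exists_continuous_character_of_representation [T2Space K] [μ.IsOpenPosMeasure]
    [μ.IsAddLeftInvariant] (hL : ∀ g, Continuous fun x => L x g) (hn : ∀ x g, ‖L x g‖ = ‖g‖)
    (h0 : L 0 = 1) (hadd : ∀ x y, L (x + y) = L x * L y) (hstar : ∀ x, star (L x) = L (-x))
    {x : K} (hx : L x ≠ 1) : ∃ χ : K →+ UnitAddCircle, Continuous χ ∧ χ x ≠ 0 := by
  -- The operators `L y` commute, so they lie in their commutant `C`; thus the bicommutant `A` is
  -- contained in `C` and is a commutative C*-algebra. It contains all `L y` and all smeared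
  -- operators.
  let C := StarSubalgebra.centralizer ℂ (Set.range L)
  let A := StarSubalgebra.centralizer ℂ (C : Set (H →L[ℂ] H))
  have hC : ∀ B ∈ C, ∀ y, B * L y = L y * B := fun B hB y =>
    ((StarSubalgebra.mem_centralizer_iff ℂ).1 hB _ ⟨y, rfl⟩).1.symm
  have hA : ∀ a, (∀ B ∈ C, B * a = a * B) → a ∈ A := fun a ha =>
    (StarSubalgebra.mem_centralizer_iff ℂ).2 fun B hB => ⟨ha B hB, ha _ (star_mem hB)⟩
  have hLC : ∀ y, L y ∈ C := by
    intro y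
    refine (StarSubalgebra.mem_centralizer_iff ℂ).2 ?_
    rintro _ ⟨z, rfl⟩
    rw [hstar]
    simp only [← hadd, add_comm, and_self]
  have hAC : A ≤ C := StarSubalgebra.centralizer_le ℂ _ _ (by rintro _ ⟨y, rfl⟩; exact hLC y)
  have hLA : ∀ y, L y ∈ A := fun y => hA _ fun B hB => hC B hB y
  have hTA : ∀ f, smearing μ L hL hn f ∈ A := fun f => hA _ fun B hB =>
    smearing_commute (hC B hB) f
  have hclosed : IsClosed (A : Set (H →L[ℂ] H)) := Set.isClosed_centralizer _
  let _ : CommCStarAlgebra A :=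
    { StarSubalgebra.cstarAlgebra A with
      mul_comm := fun a b => Subtype.ext
        (((StarSubalgebra.mem_centralizer_iff ℂ).1 b.2 a (hAC a.2)).1) }
  let M : K → A := fun y => ⟨L y, hLA y⟩
  let T : C(K, ℂ) → A := fun f => ⟨smearing μ L hL hn f, hTA f⟩
  have hT : Continuous T := (smearing μ L hL hn).continuous.subtype_mk _
  have hMT : ∀ y f, M y * T f = T (translates f y) := fun y f =>
    Subtype.ext (mul_smearing hadd f y)
  have hM : ∀ y z, M (y + z) = M y * M z := fun y z => Subtype.ext (hadd y z)
  have hM0 : M 0 = 1 := Subtype.ext h0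
  have hMs : ∀ y, star (M y) = M (-y) := fun y => Subtype.ext (hstar y)
  obtain ⟨f, hf⟩ := exists_mul_smearing_ne (μ := μ) (hL := hL) (hn := hn) h0 hx
  -- The Gelfand transform is injective, so some `φ` detects this nonzero element; `y ↦ φ (M y)`
  -- will be the character.
  obtain ⟨φ, hφ⟩ : ∃ φ : WeakDual.characterSpace ℂ A, φ (M x * T f - T f) ≠ 0 := by
    by_contra! h
    have h1 : M x * T f - T f = 0 := (gelfandTransform_isometry A).injective (by
      ext φ
      rw [map_zero]
      exact h φ)
    exact hf (congrArg Subtype.val (sub_eq_zero.1 h1))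
  rw [map_sub, map_mul] at hφ
  have hTf : φ (T f) ≠ 0 := fun h => hφ (by simp [h])
  have hφx : φ (M x) ≠ 1 := fun h => hφ (by simp [h])
  have hnorm : ∀ y, φ (M y) ∈ Submonoid.unitSphere ℂ := by
    intro y
    have h1 : star (φ (M y)) * φ (M y) = 1 := by
      rw [← map_star, hMs, ← map_mul, ← hM, neg_add_cancel, hM0, map_one]
    have h2 : ‖φ (M y)‖ * ‖φ (M y)‖ = 1 := by
      have := congrArg norm h1
      rwa [norm_mul, norm_star, norm_one] at this
    refine mem_sphere_zero_iff_norm.2 ?_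
    nlinarith [norm_nonneg (φ (M y))]
  -- `M` itself need not be norm continuous; dividing by `φ (T f) ≠ 0` expresses `φ (M y)` through
  -- norm-continuous smeared operators.
  have hcont : Continuous fun y => φ (M y) := by
    have : (fun y => φ (M y)) = fun y => φ (T (translates f y)) / φ (T f) := by
      ext y
      rw [← hMT, map_mul, mul_div_cancel_right₀ _ hTf]
    rw [this]
    exact ((map_continuous φ).comp (hT.comp (translates f).continuous)).div_const _
  let ψ : K → Circle := fun y => ⟨φ (M y), hnorm y⟩
  have hψ : ∀ y z, ψ (y + z) = ψ y * ψ z := fun y z => Subtype.ext (by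
    change φ (M (y + z)) = φ (M y) * φ (M z)
    rw [hM, map_mul])
  let e := AddCircle.homeomorphCircle (one_ne_zero (α := ℝ))
  have he : ∀ a b, e (a + b) = e a * e b := fun a b => by
    simp only [e, AddCircle.homeomorphCircle_apply, AddCircle.toCircle_add]
  refine ⟨AddMonoidHom.mk' (fun y => e.symm (ψ y)) fun y z => e.injective ?_, ?_, fun h => ?_⟩
  · rw [he]
    simp only [e.apply_symm_apply, hψ]
  · exact e.symm.continuous.comp (hcont.subtype_mk _)
  · have h1 : ψ x = e 0 := by
      rw [← e.apply_symm_apply (ψ x)]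
      exact congrArg e h
    rw [AddCircle.homeomorphCircle_apply, AddCircle.toCircle_zero] at h1
    exact hφx (congrArg Subtype.val h1)

end Representation

/-! ### Compact and precompact groups carry the topology of their characters. -/

section CompactGroup

open MeasureTheory ContinuousLinearMap

/-- Continuous characters of a compact Hausdorff abelian group separate points from zero. -/
theorem exists_continuous_character_ne_zero {K : Type*} [AddCommGroup K] [TopologicalSpace K]
    [IsTopologicalAddGroup K] [CompactSpace K] [T2Space K] {x : K} (hx : x ≠ 0) :
    ∃ χ : K →+ UnitAddCircle, Continuous χ ∧ χ x ≠ 0 := by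
  let _ : MeasurableSpace K := borel K
  have : BorelSpace K := ⟨rfl⟩
  let μ : Measure K := Measure.addHaar
  have hmp : ∀ y : K, MeasurePreserving (y + ·) μ μ := measurePreserving_add_left μ
  have : Fact ((1 : ENNReal) ≤ 2) := ⟨by norm_num⟩
  let L₀ : K → Lp ℂ 2 μ →ₗᵢ[ℂ] Lp ℂ 2 μ := fun y =>
    Lp.compMeasurePreservingₗᵢ ℂ (y + ·) (hmp y)
  have hcont : ∀ g, Continuous fun y => L₀ y g := fun g =>
    Continuous.compMeasurePreservingLp continuous_const
      (ContinuousMap.mk (fun p : K × K => p.1 + p.2) continuous_add).curry.continuous hmp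
      (by norm_num)
  have h0 : ∀ g, L₀ 0 g = g := by
    intro g
    refine Lp.ext ((Lp.coeFn_compMeasurePreserving g (hmp 0)).trans ?_)
    simp [Function.comp_def]
  have hadd : ∀ y z g, L₀ (y + z) g = L₀ y (L₀ z g) := by
    intro y z g
    refine Lp.ext ((Lp.coeFn_compMeasurePreserving g (hmp (y + z))).trans ?_)
    refine EventuallyEq.symm ((Lp.coeFn_compMeasurePreserving _ (hmp y)).trans ?_)
    have := (hmp y).quasiMeasurePreserving.ae_eq_comp
      (Lp.coeFn_compMeasurePreserving g (hmp z))
    refine this.trans (ae_of_all _ fun w => ?_)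
    simp [add_left_comm, add_assoc]
  -- This is the regular representation on `L²`.
  refine exists_continuous_character_of_representation (μ := μ)
    (L := fun y => (L₀ y).toContinuousLinearMap) hcont (fun y g => (L₀ y).norm_map g)
    (ContinuousLinearMap.ext h0) (fun y z => ContinuousLinearMap.ext (hadd y z)) ?_ ?_
  · intro y
    rw [star_eq_adjoint, eq_comm, eq_adjoint_iff]
    intro f g
    have h1 := (L₀ y).inner_map_map (L₀ (-y) f) g
    rw [← hadd, add_neg_cancel, h0] at h1
    exact h1.symm
  -- If translation by `x` fixed the indicator of `U`, the nonempty open set of `y ∈ U` with `x + y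
  -- ∈ V` would be null.
  · intro h
    obtain ⟨U, V, hU, hV, h0U, hxV, hUV⟩ := t2_separation hx.symm
    let g : Lp ℂ 2 μ := indicatorConstLp 2 hU.measurableSet (measure_ne_top μ U) 1
    have hg : g =ᵐ[μ] U.indicator fun _ => 1 := indicatorConstLp_coeFn
    have h1 : L₀ x g = g := congrArg (fun A : Lp ℂ 2 μ →L[ℂ] Lp ℂ 2 μ => A g) h
    have h2 := Lp.coeFn_compMeasurePreserving g (hmp x)
    change L₀ x g =ᵐ[μ] _ at h2
    rw [h1] at h2
    have h3 := (hg.symm.trans h2).trans ((hmp x).quasiMeasurePreserving.ae_eq_comp hg)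
    have hW : IsOpen (U ∩ (x + ·) ⁻¹' V) := hU.inter (hV.preimage (continuous_const_add x))
    refine (hW.measure_pos μ ⟨0, h0U, by simpa using hxV⟩).ne' (measure_mono_null ?_ h3)
    rintro y ⟨hyU, hyV⟩ hy
    have hyU' : x + y ∉ U := fun hm => Set.disjoint_left.1 hUV hm hyV
    simp [Set.indicator_of_mem hyU, Set.indicator_of_notMem hyU'] at hy

/-- A compact abelian group carries the topology induced by its continuous characters. -/
theorem isInducing_continuous_characters_of_compact {K : Type*} [AddCommGroup K]
    [TopologicalSpace K] [IsTopologicalAddGroup K] [CompactSpace K] [T2Space K] :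
    IsInducing fun (x : K) (χ : {χ : K →+ UnitAddCircle // Continuous χ}) => χ.1 x := by
  refine (Continuous.isClosedEmbedding (continuous_pi fun χ => χ.2) fun x y hxy => ?_).isInducing
  by_contra hne
  obtain ⟨χ, hχ, hχ0⟩ := exists_continuous_character_ne_zero (sub_ne_zero.2 hne)
  exact hχ0 (by rw [map_sub, sub_eq_zero]; exact congrFun hxy ⟨χ, hχ⟩)

/-- A precompact group carries the topology induced by its continuous characters. -/
theorem IsPrecompactGroupTopology.isInducing_characters {G : Type*} [AddCommGroup G]
    [τ : TopologicalSpace G] (h : IsPrecompactGroupTopology τ) :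
    IsInducing fun (x : G) (χ : {χ : G →+ UnitAddCircle // Continuous χ}) => χ.1 x := by
  have := h.isTopologicalAddGroup
  have := h.t2Space
  let _ := IsTopologicalAddGroup.rightUniformSpace G
  have : IsUniformAddGroup G := isUniformAddGroup_of_addCommGroup
  let ι : G →+ UniformSpace.Completion G := UniformSpace.Completion.toCompl
  have hι : IsInducing ι := (UniformSpace.Completion.isUniformInducing_coe G).isInducing
  have : CompactSpace (UniformSpace.Completion G) := by
    rw [← isCompact_univ_iff, isCompact_iff_totallyBounded_isComplete]
    refine ⟨?_, isComplete_univ⟩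
    have := (h.totallyBounded.image
      (UniformSpace.Completion.uniformContinuous_coe G)).closure
    rwa [Set.image_univ, UniformSpace.Completion.denseRange_coe.closure_range] at this
  have hK := isInducing_continuous_characters_of_compact (K := UniformSpace.Completion G)
  -- The restrictions to `G` of characters of the completion already induce the topology, and they
  -- are among all continuous characters.
  refine IsInducing.of_comp (continuous_pi fun χ => χ.2) (g := fun
    (y : {χ : G →+ UnitAddCircle // Continuous χ} → UnitAddCircle)
    (χ : {χ : UniformSpace.Completion G →+ UnitAddCircle // Continuous χ}) =>
      y ⟨χ.1.comp ι, χ.2.comp hι.continuous⟩) (continuous_pi fun χ => continuous_apply _) ?_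
  exact hK.comp hι

/-- A precompact topology is coarser than any topology for which all of its continuous
characters are continuous. -/
theorem IsPrecompactGroupTopology.le_of_continuous_characters {G : Type*} [AddCommGroup G]
    {τ σ : TopologicalSpace G} (h : IsPrecompactGroupTopology σ)
    (hχ : ∀ χ : G →+ UnitAddCircle, Continuous[σ, _] χ → Continuous[τ, _] χ) : τ ≤ σ := by
  rw [(@IsPrecompactGroupTopology.isInducing_characters G _ σ h).eq_induced,
    ← continuous_iff_le_induced]
  exact @continuous_pi _ _ _ τ _ _ fun χ => hχ χ.1 χ.2

end CompactGroup

/-! ### Uncountable groups have more characters than elements. -/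

section DualCardinality

open Cardinal

/-- The divisible group `ℚ × ℚ/ℤ` contains elements of every order. -/
theorem exists_addOrderOf_eq (n : ℕ) : ∃ c : ℚ × AddCircle (1 : ℚ), addOrderOf c = n := by
  rcases n.eq_zero_or_pos with rfl | hn
  · refine ⟨(1, 0), ?_⟩
    rw [Prod.addOrderOf_mk, addOrderOf_eq_zero_iff.2]
    · simp
    · simp [isOfFinAddOrder_iff_nsmul_eq_zero]
  · refine ⟨(0, ((1 / n : ℚ) : AddCircle (1 : ℚ))), ?_⟩
    rw [Prod.addOrderOf_mk, AddCircle.addOrderOf_period_div hn]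
    simp

/-- Send `a` to an element of the same order. The target is chosen countable and divisible, as the
cardinal estimate requires. -/
theorem exists_injective_of_cyclic {Q : Type*} [AddCommGroup Q] {P : Submodule ℤ Q} {a : Q}
    (hP : P = Submodule.span ℤ {a}) :
    ∃ f : P →ₗ[ℤ] ℚ × AddCircle (1 : ℚ), Function.Injective f := by
  subst hP
  obtain ⟨c, hc⟩ := exists_addOrderOf_eq (addOrderOf a)
  let l : (ℤ ⧸ Ideal.span {(addOrderOf a : ℤ)}) →ₗ[ℤ] ℚ × AddCircle (1 : ℚ) :=
    Submodule.liftQSpanSingleton _ (LinearMap.toSpanSingleton ℤ _ c) (by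
      rw [LinearMap.toSpanSingleton_apply, ← addOrderOf_dvd_iff_zsmul_eq_zero, hc])
  let e := CharacterModule.intSpanEquivQuotAddOrderOf a
  refine ⟨l ∘ₗ e.toLinearMap, (injective_iff_map_eq_zero _).2 fun x hx => ?_⟩
  obtain ⟨k, hk⟩ := Submodule.mem_span_singleton.1 x.2
  have hx' : x = k • ⟨a, Submodule.mem_span_singleton_self a⟩ := Subtype.ext hk.symm
  have h1 : e x = Submodule.Quotient.mk k := by
    rw [hx', map_zsmul, CharacterModule.intSpanEquivQuotAddOrderOf_apply_self,
      ← Submodule.Quotient.mk_smul]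
    simp
  have h2 : k • c = 0 := by
    have : l (e x) = 0 := hx
    rw [h1] at this
    exact this
  refine Subtype.ext ?_
  rw [← hk]
  rwa [← addOrderOf_dvd_iff_zsmul_eq_zero, hc, addOrderOf_dvd_iff_zsmul_eq_zero] at h2

theorem baer_dfinsupp {ι C : Type*} [AddCommGroup C] [DivisibleBy C ℤ] :
    Module.Baer ℤ (Π₀ _ : ι, C) := by
  classical
  let _ : DivisibleBy (Π₀ _ : ι, C) ℤ := divisibleByOfSMulRightSurj _ _ fun {n} hn f => by
    induction f using DFinsupp.induction with
    | h0 => exact ⟨0, smul_zero _⟩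
    | ha i b f _ _ ih =>
      obtain ⟨g, hg⟩ := ih
      refine ⟨DFinsupp.single i (DivisibleBy.div b n) + g, ?_⟩
      simp only at hg ⊢
      rw [smul_add, hg, ← DFinsupp.single_smul, DivisibleBy.div_cancel b hn]
  exact Module.Baer.of_divisible _

/-- A maximal independent family of cyclic subgroups generates an essential subgroup. -/
theorem exists_sSupIndep_cyclic_essential (Q : Type*) [AddCommGroup Q] :
    ∃ S : Set (Submodule ℤ Q), sSupIndep S ∧ (∀ P ∈ S, ∃ a ≠ 0, P = Submodule.span ℤ {a}) ∧
      ∀ P : Submodule ℤ Q, Disjoint P (sSup S) → P = ⊥ := by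
  obtain ⟨S, hS⟩ := zorn_subset
    {S : Set (Submodule ℤ Q) | sSupIndep S ∧ ∀ P ∈ S, ∃ a ≠ 0, P = Submodule.span ℤ {a}}
    fun c hc hchain => ⟨⋃₀ c, ⟨iSupIndep_sUnion_of_directed hchain.directedOn
      fun s hs => (hc hs).1, fun P ⟨s, hs, hP⟩ => (hc hs).2 P hP⟩,
      fun _ => Set.subset_sUnion_of_mem⟩
  refine ⟨S, hS.prop.1, hS.prop.2, fun P hP => ?_⟩
  rw [Submodule.eq_bot_iff]
  intro x hx
  by_contra hx0
  have hd : Disjoint (Submodule.span ℤ {x}) (sSup S) :=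
    hP.mono_left ((Submodule.span_singleton_le_iff_mem _ _).2 hx)
  have hins : insert (Submodule.span ℤ {x}) S ∈
      {S : Set (Submodule ℤ Q) | sSupIndep S ∧ ∀ P ∈ S, ∃ a ≠ 0, P = Submodule.span ℤ {a}} := by
    refine ⟨fun R hR => ?_, fun R hR => ?_⟩
    · rcases eq_or_ne R (Submodule.span ℤ {x}) with rfl | hne
      · exact hd.mono_right (sSup_le_sSup (by simp))
      · have hRS := hR.resolve_left hne
        rw [Set.insert_sdiff_of_notMem _ (by simpa using hne.symm), sSup_insert, sup_comm]
        refine (hS.prop.1 hRS).disjoint_sup_right_of_disjoint_sup_left ?_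
        rw [← sSup_insert, Set.insert_sdiff_singleton, Set.insert_eq_of_mem hRS]
        exact hd.symm
    · rcases hR with rfl | hR
      · exact ⟨x, hx0, rfl⟩
      · exact hS.prop.2 R hR
  have hmem := hS.le_of_ge hins (Set.subset_insert _ _) (Set.mem_insert _ _)
  have := hd.mono_right (le_sSup hmem)
  rw [disjoint_self, Submodule.span_singleton_eq_bot] at this
  exact hx0 this

/-- A maximal independent family `S` of cyclic subgroups spans an essential subgroup, so `Q` embeds
in a direct sum of `#S` countable divisible groups and `#Q ≤ #S`. Independence lets each subset of
`S` be coded by a character, which gives `2 ^ #S` of them. -/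
theorem mk_lt_mk_characterModule (Q : Type*) [AddCommGroup Q] [Uncountable Q] :
    #Q < #(CharacterModule Q) := by
  classical
  obtain ⟨S, hind, hcyc, hess⟩ := exists_sSupIndep_cyclic_essential Q
  choose! a ha0 ha using hcyc
  let p : S → Submodule ℤ Q := Subtype.val
  let j : (Π₀ P : S, p P) →ₗ[ℤ] Q := DFinsupp.lsum ℕ fun P => (p P).subtype
  have hj : Function.Injective j := ((sSupIndep_iff S).1 hind).dfinsupp_lsum_injective
  have hjr : LinearMap.range j = sSup S := by
    rw [sSup_eq_iSup']
    exact (Submodule.iSup_eq_range_dfinsupp_lsum p).symm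
  have hemb : ∀ P : S, ∃ f : p P →ₗ[ℤ] ℚ × AddCircle (1 : ℚ), Function.Injective f :=
    fun P => exists_injective_of_cyclic (ha P P.2)
  choose f hf using hemb
  obtain ⟨h, hh⟩ := baer_dfinsupp.extension_property j hj (DFinsupp.mapRange.linearMap f)
  -- The kernel of `h` meets the essential subgroup trivially, because `h` is injective there.
  have hhinj : Function.Injective h := by
    rw [← LinearMap.ker_eq_bot]
    refine hess _ ?_
    rw [Submodule.disjoint_def, ← hjr]
    rintro _ hx ⟨m, rfl⟩
    have h1 : DFinsupp.mapRange.linearMap f m = 0 := by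
      rw [← hh]
      exact hx
    have h2 : m = 0 := by
      refine (DFinsupp.mapRange_injective (fun P => f P) fun P => map_zero _).2 hf ?_
      exact h1.trans (map_zero (DFinsupp.mapRange.linearMap f)).symm
    rw [h2, map_zero]
  have hC : Countable (AddCircle (1 : ℚ)) :=
    (QuotientAddGroup.mk_surjective (s := AddSubgroup.zmultiples (1 : ℚ))).countable
  let e := (finsuppEquivDFinsupp (ι := S) (M := ℚ × AddCircle (1 : ℚ))).symm
  have heinj := e.injective.comp hhinj
  have hSinf : Infinite S := by
    by_contra hfin
    rw [not_infinite_iff_finite] at hfin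
    exact not_countable heinj.countable
  have hQS : #Q ≤ #S := by
    have h1 := Cardinal.mk_le_of_injective heinj
    rw [mk_finsupp_lift_of_infinite, lift_uzero] at h1
    refine h1.trans (max_le le_rfl ?_)
    exact (lift_le_aleph0.2 (mk_le_aleph0 (α := ℚ × AddCircle (1 : ℚ)))).trans
      (aleph0_le_mk S)
  refine hQS.trans_lt ((cantor #S).trans_le ?_)
  have hmem : ∀ P : S, a P ∈ p P := fun P =>
    (Submodule.ext_iff.1 (ha P P.2) _).2 (Submodule.mem_span_singleton_self _)
  have hchar : ∀ P : S, ∃ χ : CharacterModule (p P), χ ⟨a P, hmem P⟩ ≠ 0 := fun P =>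
    CharacterModule.exists_character_apply_ne_zero_of_ne_zero fun h0 =>
      ha0 P P.2 (congrArg Subtype.val h0)
  choose χ hχ using hchar
  -- Divisibility of `ℚ/ℤ` extends to `Q` the character that is `χ P` for `P ∈ A` and zero on the
  -- other summands; its values at the generators recover `A`.
  have hext : ∀ A : Set S, ∃ ψ : Q →ₗ[ℤ] AddCircle (1 : ℚ), ψ ∘ₗ j =
      DFinsupp.lsum ℕ fun P => if P ∈ A then AddMonoidHom.toIntLinearMap (χ P) else 0 := fun A =>
    (Module.Baer.of_divisible _).extension_property j hj _
  choose ψ hψ using hext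
  rw [← mk_set]
  refine Cardinal.mk_le_of_injective (f := fun A => ((ψ A).toAddMonoidHom : CharacterModule Q))
    fun A B hAB => ?_
  have hAB' : ψ A = ψ B := LinearMap.ext fun x => DFunLike.congr_fun hAB x
  ext P
  have h1 := LinearMap.congr_fun (hψ A) (DFinsupp.single P ⟨a P, hmem P⟩)
  have h2 := LinearMap.congr_fun (hψ B) (DFinsupp.single P ⟨a P, hmem P⟩)
  rw [hAB'] at h1
  have h3 := h1.symm.trans h2
  rw [DFinsupp.lsum_single, DFinsupp.lsum_single] at h3
  have := hχ P
  split_ifs at h3 with hA hB hB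
  · simp [hA, hB]
  · exact absurd h3 this
  · exact absurd h3.symm this
  · simp [hA, hB]

/-- The inclusion of `ℚ/ℤ` in `ℝ/ℤ`. -/
noncomputable def ratAddCircleToReal : AddCircle (1 : ℚ) →+ UnitAddCircle :=
  QuotientAddGroup.map _ _ (Rat.castHom ℝ).toAddMonoidHom (by
    rw [AddSubgroup.zmultiples_le]
    exact ⟨1, by simp⟩)

theorem ratAddCircleToReal_injective : Function.Injective ratAddCircleToReal := by
  refine (injective_iff_map_eq_zero _).2 fun x hx => ?_
  obtain ⟨q, rfl⟩ := QuotientAddGroup.mk_surjective x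
  obtain ⟨n, hn⟩ := (AddCircle.coe_eq_zero_iff (1 : ℝ)).1
    (show (((q : ℚ) : ℝ) : UnitAddCircle) = 0 from hx)
  refine (AddCircle.coe_eq_zero_iff (1 : ℚ)).2 ⟨n, ?_⟩
  simp only [zsmul_eq_mul, mul_one] at hn ⊢
  exact_mod_cast hn

/-- An uncountable abelian group has more characters than elements. -/
theorem mk_lt_mk_characters (Q : Type*) [AddCommGroup Q] [Uncountable Q] :
    #Q < #(Q →+ UnitAddCircle) :=
  (mk_lt_mk_characterModule Q).trans_le (Cardinal.mk_le_of_injective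
    (f := fun χ : CharacterModule Q => ratAddCircleToReal.comp χ) fun _ _ h =>
      AddMonoidHom.ext fun x => ratAddCircleToReal_injective (DFunLike.congr_fun h x))

end DualCardinality

/-! ### Characterized topologies of small weight live on countable groups. -/

section Necessity

open Cardinal

theorem IsPrecompactGroupTopology.prod_compact {G K : Type*} [AddCommGroup G] [AddCommGroup K]
    [τ : TopologicalSpace G] [TopologicalSpace K] [IsTopologicalAddGroup K] [T2Space K]
    [CompactSpace K] (h : IsPrecompactGroupTopology τ) :
    IsPrecompactGroupTopology (inferInstance : TopologicalSpace (G × K)) := by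
  obtain ⟨h1, h2, h3⟩ := (isPrecompactGroupTopology_iff τ).1 h
  refine (isPrecompactGroupTopology_iff _).2 ⟨inferInstance, inferInstance, fun U hU => ?_⟩
  rw [Prod.zero_eq_mk, nhds_prod_eq] at hU
  obtain ⟨V, hV, W, hW, hVW⟩ := mem_prod_iff.1 hU
  obtain ⟨F, hF, hFV⟩ := h3 V hV
  obtain ⟨F', hF', hFW⟩ : ∃ F' : Set K, F'.Finite ∧
      Set.univ ⊆ ⋃ x ∈ F', (fun y => x + y) '' W := by
    let _ := IsTopologicalAddGroup.rightUniformSpace K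
    have : IsUniformAddGroup K := isUniformAddGroup_of_addCommGroup
    exact totallyBounded_iff_subset_finite_iUnion_nhds_zero.1 isCompact_univ.totallyBounded W hW
  refine ⟨F ×ˢ F', hF.prod hF', ?_⟩
  rintro ⟨x, y⟩ -
  obtain ⟨a, ha, v, hv, hx⟩ := Set.mem_iUnion₂.1 (hFV (Set.mem_univ x))
  obtain ⟨b, hb, w, hw, hy⟩ := Set.mem_iUnion₂.1 (hFW (Set.mem_univ y))
  exact Set.mem_iUnion₂.2 ⟨(a, b), ⟨ha, hb⟩, (v, w), hVW ⟨hv, hw⟩, Prod.ext hx hy⟩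

theorem IsPrecompactGroupTopology.induced {G K : Type*} [AddCommGroup G] [AddCommGroup K]
    [κ : TopologicalSpace K] (h : IsPrecompactGroupTopology κ) (ι : G →+ K)
    (hι : Function.Injective ι) : IsPrecompactGroupTopology (κ.induced ι) := by
  have := h.isTopologicalAddGroup
  have := h.t2Space
  let _ : TopologicalSpace G := κ.induced ι
  have hind : IsInducing ι := ⟨rfl⟩
  have hG : IsTopologicalAddGroup G := topologicalAddGroup_induced ι
  refine ⟨hG, T2Space.of_injective_continuous hι hind.continuous, ?_⟩
  let _ := IsTopologicalAddGroup.rightUniformSpace K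
  have : IsUniformAddGroup K := isUniformAddGroup_of_addCommGroup
  let _ := IsTopologicalAddGroup.rightUniformSpace G
  have : IsUniformAddGroup G := isUniformAddGroup_of_addCommGroup
  exact totallyBounded_preimage (AddMonoidHom.isUniformInducing_of_isInducing hind)
    h.totallyBounded

/-- In the finest precompact topology in which `u` converges to zero, every character along
which `u` converges to zero is continuous. -/
theorem continuous_of_isLeast_of_tendsto {G : Type*} [AddCommGroup G] [τ : TopologicalSpace G]
    {u : ℕ → G} (h : IsLeast (precompactTopologiesConverging u) τ) {χ : G →+ UnitAddCircle}
    (hχ : Tendsto (fun n => χ (u n)) atTop (𝓝 0)) : Continuous χ := by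
  -- Pulling back along the graph of `χ` gives the join of `τ` with the topology induced by `χ`;
  -- leastness of `τ` forces `χ` to be continuous already.
  let ι : G →+ G × UnitAddCircle := (AddMonoidHom.id G).prod χ
  have hmem : TopologicalSpace.induced ι inferInstance ∈ precompactTopologiesConverging u := by
    refine ⟨h.1.1.prod_compact.induced ι fun x y hxy => congrArg Prod.fst hxy, ?_⟩
    rw [nhds_induced, tendsto_comap_iff, map_zero]
    exact h.1.2.prodMk_nhds hχ
  exact continuous_snd.comp (continuous_iff_le_induced.2 (h.2 hmem))

/-- A precompact group has at most as many continuous characters as basic open sets, up to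
countable factors. -/
theorem IsPrecompactGroupTopology.mk_continuous_characters_le {G : Type*} [AddCommGroup G]
    [τ : TopologicalSpace G] (h : IsPrecompactGroupTopology τ) {B : Set (Set G)}
    (hB : TopologicalSpace.IsTopologicalBasis B) :
    #{χ : G →+ UnitAddCircle // Continuous χ} ≤ #B * ℵ₀ := by
  have hU : ∀ χ : {χ : G →+ UnitAddCircle // Continuous χ},
      ∃ U : B, U.1 ∈ 𝓝 (0 : G) ∧ χ.1 ∈ smallCharacters U.1 := by
    rintro ⟨χ, hχ⟩
    have hmem : χ ⁻¹' Metric.closedBall 0 (1 / 16) ∈ 𝓝 (0 : G) :=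
      hχ.continuousAt.preimage_mem_nhds (by
        rw [map_zero]
        exact Metric.closedBall_mem_nhds _ (by norm_num))
    obtain ⟨U, hUB, h0, hsub⟩ := hB.mem_nhds_iff.1 hmem
    exact ⟨⟨U, hUB⟩, hB.mem_nhds hUB h0, fun x hx => by simpa using hsub hx⟩
  -- Each character is assigned a basic neighbourhood on which it is small; the fibres are finite.
  choose U hU0 hUχ using hU
  refine mk_le_mk_mul_of_mk_preimage_le U fun V => ?_
  rcases (U ⁻¹' {V}).eq_empty_or_nonempty with he | ⟨χ₀, hχ₀⟩
  · simp [he]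
  · refine (Set.Countable.le_aleph0 (Set.Finite.countable ?_))
    refine Set.Finite.of_finite_image (f := Subtype.val)
      ((h.finite_smallCharacters (hU0 χ₀)).subset ?_) Subtype.val_injective.injOn
    rintro _ ⟨χ, hχ, rfl⟩
    have := hUχ χ
    rw [hχ] at this
    rwa [hχ₀]

/-- If `G` were uncountable, factoring out the countable `N` would preserve its cardinality, and the
characters of `G ⧸ N`, all continuous on `G`, would outnumber the bound `#B * ℵ₀ ≤ #G`. -/
theorem IsSSCharacterized.countable {G : Type*} [AddCommGroup G] [τ : TopologicalSpace G]
    (h : IsSSCharacterized τ) {B : Set (Set G)} (hB : TopologicalSpace.IsTopologicalBasis B)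
    (hBG : #B ≤ #G) : Countable G := by
  obtain ⟨u, -, hleast⟩ := h
  by_contra hunc
  rw [not_countable_iff] at hunc
  let N := (Finsupp.linearCombination ℤ u).toAddMonoidHom.range
  have hN : Countable N := (Set.countable_range (Finsupp.linearCombination ℤ u)).to_subtype
  have huN : ∀ n, u n ∈ N := fun n => ⟨Finsupp.single n 1, by simp⟩
  let e : G ≃ (G ⧸ N) × N := AddSubgroup.addGroupEquivQuotientProdAddSubgroup
  have hprod : #G = #(G ⧸ N) * #N := (mk_congr e).trans (by simp)
  have hunc' : Uncountable (G ⧸ N) := by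
    by_contra hc
    rw [not_uncountable_iff] at hc
    exact not_countable e.injective.countable
  have hle : #G ≤ #(G ⧸ N) := by
    rw [hprod]
    exact (mul_le_mul' le_rfl mk_le_aleph0).trans_eq (mul_aleph0_eq (aleph0_le_mk _))
  have hinj : #(G ⧸ N →+ UnitAddCircle) ≤ #{χ : G →+ UnitAddCircle // Continuous χ} := by
    refine mk_le_of_injective (f := fun χ => ⟨χ.comp (QuotientAddGroup.mk' N),
      continuous_of_isLeast_of_tendsto hleast ?_⟩) fun χ ψ hχψ => ?_
    · have : ∀ n, χ.comp (QuotientAddGroup.mk' N) (u n) = 0 := fun n => by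
        have : QuotientAddGroup.mk' N (u n) = 0 :=
          (QuotientAddGroup.eq_zero_iff _).2 (huN n)
        rw [AddMonoidHom.comp_apply, this, map_zero]
      simp only [this, tendsto_const_nhds_iff]
    · exact (AddMonoidHom.cancel_right (QuotientAddGroup.mk'_surjective N)).1
        (congrArg Subtype.val hχψ)
  have h1 := (mk_lt_mk_characters (G ⧸ N)).trans_le
    (hinj.trans (hleast.1.1.mk_continuous_characters_le hB))
  exact absurd (h1.trans_le ((mul_le_mul' hBG le_rfl).trans_eq
    (mul_aleph0_eq (aleph0_le_mk G)))) hle.not_gt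

end Necessity

/-! ### Constructing a characterizing sequence. -/

section Sufficiency

theorem exists_finite_separating {G : Type*} [AddCommGroup G] {P : Set (G →+ UnitAddCircle)}
    (hP : P.Finite) : ∃ E : Set G, E.Finite ∧
      ∀ χ ∈ P, ∀ ψ ∈ P, (∀ x ∈ E, ‖χ x - ψ x‖ ≤ 1 / 4) → χ = ψ := by
  have h : ∀ q : (G →+ UnitAddCircle) × (G →+ UnitAddCircle), ∃ x : G,
      ‖q.1 x - q.2 x‖ ≤ 1 / 4 → q.1 = q.2 := by
    intro q
    by_contra! h
    exact (h 0).2 (AddMonoidHom.eq_of_norm_sub_le fun x => (h x).1)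
  choose x hx using h
  exact ⟨x '' (P ×ˢ P), (hP.prod hP).image x, fun χ hχ ψ hψ h =>
    hx (χ, ψ) (h _ ⟨(χ, ψ), ⟨hχ, hψ⟩, rfl⟩)⟩

/-- Characters that are not 1/8-close on `E` to any member of `smallCharacters U` form a compact set
in the product of circles. None is small on all of `U`, so finitely many points of `U` already
exclude them all. -/
theorem exists_finite_smallCharacters_approx {G : Type*} [AddCommGroup G] (U : Set G) {E : Set G}
    (hE : E.Finite) : ∃ A : Set G, A.Finite ∧ A ⊆ U ∧
      ∀ χ ∈ smallCharacters A, ∃ ψ ∈ smallCharacters U, ∀ x ∈ E, ‖χ x - ψ x‖ < 1 / 8 := by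
  let s : Set (G → UnitAddCircle) := Set.range (fun χ : G →+ UnitAddCircle => (χ : G → _)) ∩
    ⋂ ψ ∈ smallCharacters U, ⋃ x ∈ E, {p | 1 / 8 ≤ ‖p x - ψ x‖}
  have hs : IsCompact s := by
    refine (IsClosed.inter ?_ ?_).isCompact
    · exact AddMonoidHom.isClosed_range_coe G UnitAddCircle
    · exact isClosed_biInter fun ψ _ => hE.isClosed_biUnion fun x _ =>
        isClosed_le continuous_const ((continuous_apply x).sub continuous_const).norm
  obtain ⟨t, ht⟩ := hs.elim_finite_subfamily_closed
    (fun a : U => {p : G → UnitAddCircle | ‖p a‖ ≤ 1 / 16})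
    (fun a => isClosed_le (continuous_apply _).norm continuous_const) (by
      rw [Set.eq_empty_iff_forall_notMem]
      rintro _ ⟨⟨⟨χ, rfl⟩, hχ⟩, hχU⟩
      have hχ' : χ ∈ smallCharacters U := fun x hx => Set.mem_iInter.1 hχU ⟨x, hx⟩
      obtain ⟨x, -, hx⟩ := Set.mem_iUnion₂.1 (Set.mem_iInter₂.1 hχ χ hχ')
      norm_num at hx)
  refine ⟨Subtype.val '' (t : Set U), t.finite_toSet.image _, by simp, fun χ hχ => ?_⟩
  by_contra! hno
  refine Set.eq_empty_iff_forall_notMem.1 ht χ ⟨⟨⟨χ, rfl⟩, ?_⟩, ?_⟩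
  · refine Set.mem_iInter₂.2 fun ψ hψ => ?_
    obtain ⟨x, hx, hle⟩ := hno ψ hψ
    exact Set.mem_iUnion₂.2 ⟨x, hx, hle⟩
  · exact Set.mem_iInter₂.2 fun a ha => hχ _ ⟨a, ha, rfl⟩

/-- A sequence of nonempty finite sets can be enumerated by a single sequence. -/
theorem exists_seq_enumerating {G : Type*} (A : ℕ → Set G) (hA : ∀ n, (A n).Finite)
    (hne : ∀ n, (A n).Nonempty) : ∃ u : ℕ → G, ∀ p : G → Prop,
      (∀ᶠ k in atTop, p (u k)) ↔ ∀ᶠ n in atTop, ∀ a ∈ A n, p a := by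
  have : ∀ n, Finite (A n) := hA
  have : ∀ n, Nonempty (A n) := fun n => (hne n).to_subtype
  have : Infinite (Σ n, A n) := .of_surjective Sigma.fst Sigma.fst_surjective
  obtain ⟨e⟩ := nonempty_equiv_of_countable (α := ℕ) (β := Σ n, A n)
  refine ⟨fun k => (e k).2, fun p => ?_⟩
  -- Eventually along the sequence means cofinitely often in the disjoint union; finiteness of each
  -- `A n` turns this into cofinitely many `n`.
  have h1 : (∀ᶠ k in atTop, p (e k).2) ↔ ∀ᶠ q : Σ n, A n in cofinite, p q.2 := by
    rw [← Nat.cofinite_eq_atTop]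
    refine ⟨fun h => ?_, fun h => e.injective.tendsto_cofinite.eventually h⟩
    have := e.symm.injective.tendsto_cofinite.eventually h
    filter_upwards [this] with q hq
    rwa [e.apply_symm_apply] at hq
  rw [h1, ← Nat.cofinite_eq_atTop, eventually_cofinite, eventually_cofinite]
  constructor
  · intro h
    refine (h.image Sigma.fst).subset fun n hn => ?_
    simp only [not_forall, Set.mem_ofPred_eq] at hn
    obtain ⟨a, ha, hp⟩ := hn
    exact ⟨⟨n, a, ha⟩, hp, rfl⟩
  · intro h
    refine (h.preimage' (f := Sigma.fst) fun n _ => ?_).subset fun q hq => ?_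
    · refine (Set.finite_range (Sigma.mk (β := fun n => A n) n)).subset ?_
      rintro ⟨m, a⟩ rfl
      exact ⟨a, rfl⟩
    · simp only [not_forall, Set.mem_ofPred_eq, Set.mem_preimage]
      exact ⟨_, q.2.2, hq⟩

/-- In a countable first countable precompact group there is a null sequence along which only
continuous characters converge to zero. -/
theorem IsPrecompactGroupTopology.exists_seq_characterizing {G : Type*} [AddCommGroup G]
    [τ : TopologicalSpace G] (h : IsPrecompactGroupTopology τ) [Countable G]
    [FirstCountableTopology G] : ∃ u : ℕ → G, Tendsto u atTop (𝓝 0) ∧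
      ∀ χ : G →+ UnitAddCircle, Tendsto (fun n => χ (u n)) atTop (𝓝 0) → Continuous χ := by
  have := h.isTopologicalAddGroup
  obtain ⟨U, hU⟩ := (𝓝 (0 : G)).exists_antitone_basis
  obtain ⟨e, he⟩ := exists_surjective_nat G
  have hP : ∀ n, (smallCharacters (U n)).Finite := fun n => h.finite_smallCharacters (hU.mem n)
  -- The index `n + 1` is used because consecutive approximants, for `U n` and `U (n + 1)`, are both
  -- small on the smaller set `U (n + 1)`.
  choose D hD hDsep using fun n => exists_finite_separating (hP (n + 1))
  let E : ℕ → Set G := fun n => ⋃ k ∈ Set.Iic n, insert (e k) (D k)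
  have hE : ∀ n, (E n).Finite := fun n => (Set.finite_Iic n).biUnion fun k _ => (hD k).insert _
  have hEmono : ∀ {m n}, m ≤ n → E m ⊆ E n := fun hmn =>
    Set.biUnion_subset_biUnion_left (Set.Iic_subset_Iic.2 hmn)
  have hDE : ∀ n, D n ⊆ E n := fun n x hx =>
    Set.mem_biUnion (Set.mem_Iic.2 le_rfl) (Set.mem_insert_of_mem _ hx)
  have heE : ∀ n, e n ∈ E n := fun n => Set.mem_biUnion (Set.mem_Iic.2 le_rfl) (Set.mem_insert _ _)
  choose A hA hAU happ using fun n => exists_finite_smallCharacters_approx (U n) (hE n)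
  -- Inserting zero only ensures nonemptiness.
  obtain ⟨u, hu⟩ := exists_seq_enumerating (fun n => insert 0 (A n)) (fun n => (hA n).insert 0)
    fun n => Set.insert_nonempty _ _
  refine ⟨u, ?_, fun χ hχ => ?_⟩
  · refine hU.1.tendsto_right_iff.2 fun n _ => (hu (· ∈ U n)).2 ?_
    filter_upwards [eventually_ge_atTop n] with m hm a ha
    rcases ha with rfl | ha
    · exact mem_of_mem_nhds (hU.mem n)
    · exact hU.antitone hm (hAU m ha)
  · have hsmall : ∀ᶠ k in atTop, ‖χ (u k)‖ ≤ 1 / 16 := by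
      filter_upwards [hχ (Metric.closedBall_mem_nhds (0 : UnitAddCircle)
        (show (0 : ℝ) < 1 / 16 by norm_num))] with k hk
      simpa using hk
    obtain ⟨N, hN⟩ := eventually_atTop.1 ((hu fun x => ‖χ x‖ ≤ 1 / 16).1 hsmall)
    have hψ : ∀ n, ∃ ψ : G →+ UnitAddCircle, N ≤ n → ψ ∈ smallCharacters (U n) ∧
        ∀ x ∈ E n, ‖χ x - ψ x‖ < 1 / 8 := by
      intro n
      by_cases hn : N ≤ n
      · obtain ⟨ψ, h1, h2⟩ := happ n χ fun x hx => hN n hn x (Set.mem_insert_of_mem _ hx)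
        exact ⟨ψ, fun _ => ⟨h1, h2⟩⟩
      · exact ⟨0, fun hn' => absurd hn' hn⟩
    choose ψ hψ using hψ
    -- Consecutive approximants differ by at most 1/8 + 1/8 on `D n`, which is the separation
    -- threshold.
    have hconst : ∀ n, N ≤ n → ψ n = ψ N := by
      intro n hn
      induction n, hn using Nat.le_induction with
      | base => rfl
      | succ n hn ih =>
        rw [← ih]
        have h1 := hψ n hn
        have h2 := hψ (n + 1) (hn.trans n.le_succ)
        refine hDsep n _ h2.1 _ (smallCharacters_anti (hU.antitone n.le_succ) h1.1) fun x hx => ?_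
        have h3 := h1.2 x (hDE n hx)
        have h4 := h2.2 x (hEmono n.le_succ (hDE n hx))
        have h5 := norm_sub_le (χ x - ψ n x) (χ x - ψ (n + 1) x)
        rw [sub_sub_sub_cancel_left] at h5
        linarith
    -- The sets `E n` exhaust `G`, so the stable approximant is uniformly close to `χ`.
    have hχψ : χ = ψ N := by
      refine AddMonoidHom.eq_of_norm_sub_le fun x => ?_
      obtain ⟨k, rfl⟩ := he x
      have h1 := (hψ (max k N) (le_max_right _ _)).2 _ (hEmono (le_max_left _ _) (heE k))
      rw [hconst _ (le_max_right _ _)] at h1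
      linarith
    rw [hχψ]
    exact continuous_of_mem_smallCharacters (hU.mem N) (hψ N le_rfl).1

/-- If `u` tends to zero in a precompact `σ`, every `σ`-continuous character tends to zero along
`u`, hence is `τ`-continuous; characters determine `σ`, so `τ` is finer. -/
theorem IsPrecompactGroupTopology.isSSCharacterized {G : Type*} [AddCommGroup G]
    [τ : TopologicalSpace G] (h : IsPrecompactGroupTopology τ) [Countable G]
    [FirstCountableTopology G] : IsSSCharacterized τ := by
  obtain ⟨u, hu, hχ⟩ := h.exists_seq_characterizing
  refine ⟨u, ⟨τ, h, hu⟩, ⟨h, hu⟩, fun σ hσ => hσ.1.le_of_continuous_characters fun χ hc => hχ χ ?_⟩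
  have h0 : Tendsto χ (@nhds G σ 0) (𝓝 (χ 0)) := @Continuous.tendsto _ _ σ _ _ hc 0
  rw [map_zero] at h0
  exact h0.comp hσ.2

end Sufficiency

/-! ### The equivalence. -/

theorem corollaryC3 {G : Type*} [AddCommGroup G] [τ : TopologicalSpace G]
    (hprecompact : IsPrecompactGroupTopology τ) (hArh : IsArhangelskii G) :
    IsSSCharacterized τ ↔ TopologicalSpace.MetrizableSpace G ∧ Countable G := by
  constructor
  · intro h
    obtain ⟨B, hB, hcard⟩ : topWeight G ∈ {κ : Cardinal | ∃ B : Set (Set G),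
        TopologicalSpace.IsTopologicalBasis B ∧ Cardinal.mk B = κ} :=
      csInf_mem ⟨_, _, TopologicalSpace.isTopologicalBasis_opens, rfl⟩
    have hBG : Cardinal.mk B ≤ Cardinal.mk G := hcard.trans_le hArh
    have hG : Countable G := h.countable hB hBG
    have := hprecompact.isTopologicalAddGroup
    have := hprecompact.t2Space
    -- A base of size at most `#G` is now countable, so Urysohn metrization applies.
    have : SecondCountableTopology G := hB.secondCountableTopology
      (Cardinal.le_aleph0_iff_set_countable.1 (hBG.trans Cardinal.mk_le_aleph0))
    exact ⟨inferInstance, hG⟩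
  · rintro ⟨hm, hc⟩
    let _ := TopologicalSpace.metrizableSpaceMetric G
    exact hprecompact.isSSCharacterized
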